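/- Let $P$ and $Q$ be probability measures on a common measurable space, let $R=\tfrac12(P+Q)$, $p=\frac{dP}{dR}$, $q=\frac{dQ}{dR}$, and let the relative information be $\imath_{P\|Q}=\log p-\log q\in[-\infty,\infty]$, with distribution function $F_{P\|Q}(x)=P[\imath_{P\|Q}\le x]$, $x\in\mathbb{R}$, under $P$. For $\omega\in(0,1)$ let the DeGroot statistical information be the $f$-divergence $$I_\omega(P\|Q)=D_{\phi_\omega}(P\|Q)=\int q\,\phi_\omega\!\left(\frac pq\right)dR,\qquad \phi_\omega(t)=\min\{\omega,1-\omega\}-\min\{\omega t,1-\omega\},$$ with the conventions $\phi_\omega(0)=\lim_{t\downarrow0}\phi_\omega(t)$, $0\,\phi_\omega(0/0)=0$ and $0\,\phi_\omega(a/0)=a\lim_{u\to\infty}\phi_\omega(u)/u$ for $a>0$. Write $I'_\omega$ for the derivative with respect to $\omega$. Assume that $P[\imath_{P\|Q}=x]=0$ for every $x\in\mathbb{R}$. Then: (a) $\omega\mapsto I_\omega(P\|Q)$ is continuously differentiable on $(0,\tfrac12)\cup(\tfrac12,1)$; the one-sided limits of $I'_\omega(P\|Q)$ at $\tfrac12$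 exist in $\mathbb{R}$ and $$\lim_{\omega\uparrow\frac12}I'_\omega(P\|Q)-\lim_{\omega\downarrow\frac12}I'_\omega(P\|Q)=2;$$ $I'_\omega(P\|Q)\ge0$ on $(0,\tfrac12)$ and $I'_\omega(P\|Q)\le0$ on $(\tfrac12,1)$, so that $I_\omega(P\|Q)$ is non-decreasing on $(0,\tfrac12)$ and non-increasing on $(\tfrac12,1)$. (b) The values $I_\omega(P\|Q)$, $\omega\in(0,\tfrac12]$ (as a function of $\omega$), determine $F_{P\|Q}$ on $[0,\infty)$, and the values $I_\omega(P\|Q)$, $\omega\in(\tfrac12,1)$, determine $F_{P\|Q}$ on $(-\infty,0)$. That is, if $P',Q'$ are probability measures on a common, possibly different, measurable space with $I_\omega(P'\|Q')=I_\omega(P\|Q)$ for all $\omega\in(0,\tfrac12]$ (respectively, all $\omega\in(\tfrac12,1)$), then $F_{P'\|Q'}(x)=F_{P\|Q}(x)$ for all $x\ge0$ (respectively, all $x<0$). (c) For $\omega\in(0,\tfrac12)$, $$F_{P\|Q}\!\left(\log\tfrac{1-\omega}{\omega}\right)=1-I_\omega(P\|Q)-(1-\omega)\,I'_\omega(P\|Q);$$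 for $\omega\in(\tfrac12,1)$, $$F_{P\|Q}\!\left(\log\tfrac{1-\omega}{\omega}\right)=-I_\omega(P\|Q)-(1-\omega)\,I'_\omega(P\|Q);$$ and $$F_{P\|Q}(0)=-I_{\frac12}(P\|Q)-\tfrac12\lim_{\omega\downarrow\frac12}I'_\omega(P\|Q).$$ -/

import Mathlib

open MeasureTheory Set Filter Topology
open scoped ENNReal

/-- The dominating probability measure `R = (P + Q) / 2`. -/
noncomputable def midMeasure {A : Type*} [MeasurableSpace A] (P Q : Measure A) : Measure A :=
  (2⁻¹ : ℝ≥0∞) • (P + Q)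

/-- The relative information `log (dP/dR) - log (dQ/dR)`, with values in `[-∞, ∞]`.
It equals `+∞` where `dQ/dR = 0 < dP/dR`, and `-∞` where `dP/dR = 0 < dQ/dR`. -/
noncomputable def relInfo {A : Type*} [MeasurableSpace A] (P Q : Measure A) (a : A) : EReal :=
  ENNReal.log (P.rnDeriv (midMeasure P Q) a) - ENNReal.log (Q.rnDeriv (midMeasure P Q) a)

/-- The relative information spectrum: the cumulative distribution function of the relative
information under `P`. -/
noncomputable def relInfoSpectrum {A : Type*} [MeasurableSpace A] (P Q : Measure A) (x : ℝ) : ℝ :=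
  P.real {a | relInfo P Q a ≤ (x : EReal)}

/-- The relative information of a `P`-distributed point has no probability masses on `ℝ`. -/
def NoMasses {A : Type*} [MeasurableSpace A] (P Q : Measure A) : Prop :=
  ∀ x : ℝ, P {a | relInfo P Q a = (x : EReal)} = 0

/-- The expression `q f(p/q)` for `p, q ≥ 0`, with the conventions `f(0) = lim_{t ↓ 0} f(t)`,
`0 f(0/0) = 0` and `0 f(a/0) = a lim_{u → ∞} f(u)/u` for `a > 0`. -/
noncomputable def fIntegrand (f : ℝ → ℝ) (p q : ℝ) : ℝ :=
  if 0 < q then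
    if 0 < p then q * f (p / q) else q * limUnder (𝓝[>] (0 : ℝ)) f
  else
    if 0 < p then p * limUnder atTop (fun u : ℝ => f u / u) else 0

/-- The `f`-divergence `∫ q f(p/q) dR`, for a convex `f : (0, ∞) → ℝ` for which the two limits
in `fIntegrand` are finite (the integral then converges absolutely). -/
noncomputable def fDivergence {A : Type*} [MeasurableSpace A] (f : ℝ → ℝ) (P Q : Measure A) : ℝ :=
  ∫ a, fIntegrand f (P.rnDeriv (midMeasure P Q) a).toReal (Q.rnDeriv (midMeasure P Q) a).toReal
    ∂(midMeasure P Q)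

/-- The convex function `φ_ω` that generates the DeGroot statistical information. -/
noncomputable def deGrootFun (ω t : ℝ) : ℝ :=
  min ω (1 - ω) - min (ω * t) (1 - ω)

/-- The DeGroot statistical information of order `ω ∈ (0, 1)`. -/
noncomputable def deGrootInfo {A : Type*} [MeasurableSpace A] (P Q : Measure A) (ω : ℝ) : ℝ :=
  fDivergence (deGrootFun ω) P Q

/-! ### Pointwise identities in the densities `p`, `q`. -/

section PointwiseFormulas

/-! Since `q` has integral 1, `I_ω = min ω (1 - ω) - B ω`, where `B ω = ∫ min (ω p) ((1 - ω) q) dR`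
is the Bayes risk (`deGrootInfo_eq`). As an integral of minima of affine functions, `B` is concave,
and integrating the slope of the active branch gives a supergradient `s` with values in `[-1, 1]`.
The active branch, extended to `ω = 1`, takes the value `p` or `0`; integrating gives `B ω + (1 - ω)
s ω = F (log ((1 - ω) / ω))` for every pair of measures (`bayesRisk_add_mul_bayesSlope`).

Absence of masses makes the ties `ω p = (1 - ω) q` null, so `s` is continuous by dominated
convergence and `B' = s` on `(0, 1)`. The jump 2 thus comes only from `min ω (1 - ω)`, the signs
from `|s| ≤ 1`, and (c) from the identity above.

In (b) the pair `P', Q'` may have masses, but where its risk agrees locally with the differentiable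
`B`, its supergradient must be the derivative. At `ω = 1/2` agreement is known only on the left, and
left continuity of `s` closes the gap. -/

lemma tendsto_deGrootFun_zero {ω : ℝ} (hω : ω ∈ Ioo (0 : ℝ) 1) :
    Tendsto (deGrootFun ω) (𝓝[>] 0) (𝓝 (min ω (1 - ω))) := by
  have hc : Continuous (deGrootFun ω) := by unfold deGrootFun; fun_prop
  have h := hc.tendsto 0
  have h0 : deGrootFun ω 0 = min ω (1 - ω) := by
    simp [deGrootFun, min_eq_left (sub_nonneg.2 hω.2.le)]
  rw [h0] at h
  exact h.mono_left nhdsWithin_le_nhds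

lemma tendsto_deGrootFun_div_atTop {ω : ℝ} (hω : ω ∈ Ioo (0 : ℝ) 1) :
    Tendsto (fun u : ℝ => deGrootFun ω u / u) atTop (𝓝 0) := by
  have h : Tendsto (fun u : ℝ => (min ω (1 - ω) - (1 - ω)) / u) atTop (𝓝 0) :=
    tendsto_const_nhds.div_atTop tendsto_id
  refine h.congr' ?_
  filter_upwards [eventually_ge_atTop ((1 - ω) / ω)] with u hu
  have : 1 - ω ≤ ω * u := by
    rw [div_le_iff₀ hω.1] at hu
    linarith
  rw [deGrootFun, min_eq_right this]

/-- The two limit conventions are exactly what keeps one formula valid on `q = 0` and `p = 0`. -/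
lemma fIntegrand_deGrootFun {ω : ℝ} (hω : ω ∈ Ioo (0 : ℝ) 1) {p q : ℝ} (hp : 0 ≤ p)
    (hq : 0 ≤ q) :
    fIntegrand (deGrootFun ω) p q = min ω (1 - ω) * q - min (ω * p) ((1 - ω) * q) := by
  have h1 : 0 < 1 - ω := sub_pos.2 hω.2
  unfold fIntegrand
  rcases hq.eq_or_lt with rfl | hq
  · rw [if_neg (lt_irrefl _), mul_zero, mul_zero, min_eq_right (mul_nonneg hω.1.le hp),
      (tendsto_deGrootFun_div_atTop hω).limUnder_eq]
    simp
  · rw [if_pos hq]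
    rcases hp.eq_or_lt with rfl | hp
    · rw [if_neg (lt_irrefl _), (tendsto_deGrootFun_zero hω).limUnder_eq, mul_zero,
        min_eq_left (mul_nonneg h1.le hq.le)]
      ring
    · have h2 : q * (ω * (p / q)) = ω * p := by field_simp
      rw [if_pos hp, deGrootFun, mul_sub, mul_comm q (min ω (1 - ω)),
        mul_min_of_nonneg _ _ hq.le, h2, mul_comm q (1 - ω)]

lemma log_sub_log_le_iff {p q : ℝ≥0∞} (hp : p ≠ ∞) (hq : q ≠ ∞) (hp0 : p ≠ 0) {ω : ℝ}
    (hω : ω ∈ Ioo (0 : ℝ) 1) :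
    ENNReal.log p - ENNReal.log q ≤ (Real.log ((1 - ω) / ω) : EReal) ↔
      ω * p.toReal ≤ (1 - ω) * q.toReal := by
  have h1 : 0 < 1 - ω := sub_pos.2 hω.2
  have hpp : 0 < p.toReal := ENNReal.toReal_pos hp0 hp
  have hlp : ENNReal.log p = (Real.log p.toReal : EReal) := by
    rw [ENNReal.log_pos_real hp0 hp]
  rcases eq_or_ne q 0 with rfl | hq0
  · simp only [hlp, ENNReal.log_zero, ENNReal.toReal_zero, mul_zero]
    constructor
    · intro h
      simp at h
    · intro h
      exact absurd h (not_le.2 (mul_pos hω.1 hpp))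
  · have hqq : 0 < q.toReal := ENNReal.toReal_pos hq0 hq
    rw [hlp, ENNReal.log_pos_real hq0 hq, ← EReal.coe_sub, EReal.coe_le_coe_iff,
      ← Real.log_div hpp.ne' hqq.ne', Real.log_le_log_iff (div_pos hpp hqq) (div_pos h1 hω.1),
      div_le_div_iff₀ hqq hω.1, mul_comm ω]

lemma log_sub_log_eq_of_mul_eq {p q : ℝ≥0∞} (hp : p ≠ ∞) (hq : q ≠ ∞) (hp0 : p ≠ 0) {ω : ℝ}
    (hω : ω ∈ Ioo (0 : ℝ) 1) (h : ω * p.toReal = (1 - ω) * q.toReal) :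
    ENNReal.log p - ENNReal.log q = (Real.log ((1 - ω) / ω) : EReal) := by
  have h1 : 0 < 1 - ω := sub_pos.2 hω.2
  have hpp : 0 < p.toReal := ENNReal.toReal_pos hp0 hp
  have hqq : 0 < q.toReal := pos_of_mul_pos_right (h ▸ mul_pos hω.1 hpp) h1.le
  have hq0 : q ≠ 0 := fun h0 => by simp [h0] at hqq
  rw [ENNReal.log_pos_real hp0 hp, ENNReal.log_pos_real hq0 hq, ← EReal.coe_sub,
    ← Real.log_div hpp.ne' hqq.ne']
  congr 2
  rw [div_eq_div_iff hqq.ne' hω.1.ne']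
  linarith

/-- A supergradient of `ω ↦ min (ω p) ((1 - ω) q)`. -/
noncomputable def minSlope (p q ω : ℝ) : ℝ := if ω * p ≤ (1 - ω) * q then p else -q

/-- The minimum lies below both affine branches, in particular below the one active at `ω`. -/
lemma min_le_min_add_minSlope (p q ω ω' : ℝ) :
    min (ω' * p) ((1 - ω') * q) ≤ min (ω * p) ((1 - ω) * q) + (ω' - ω) * minSlope p q ω := by
  unfold minSlope
  split_ifs with h
  · rw [min_eq_left h]
    exact (min_le_left _ _).trans (by linarith)
  · rw [min_eq_right (le_of_not_ge h)]
    exact (min_le_right _ _).trans (by linarith)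

lemma min_add_mul_minSlope (p q ω : ℝ) :
    min (ω * p) ((1 - ω) * q) + (1 - ω) * minSlope p q ω =
      if ω * p ≤ (1 - ω) * q then p else 0 := by
  unfold minSlope
  split_ifs with h
  · rw [min_eq_left h]; ring
  · rw [min_eq_right (le_of_not_ge h)]; ring

lemma neg_le_minSlope {p q : ℝ} (hp : 0 ≤ p) (hq : 0 ≤ q) (ω : ℝ) : -q ≤ minSlope p q ω := by
  unfold minSlope
  split_ifs <;> linarith

lemma minSlope_le {p q : ℝ} (hp : 0 ≤ p) (hq : 0 ≤ q) (ω : ℝ) : minSlope p q ω ≤ p := by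
  unfold minSlope
  split_ifs <;> linarith

lemma norm_minSlope_le {p q : ℝ} (hp : 0 ≤ p) (hq : 0 ≤ q) (ω : ℝ) :
    ‖minSlope p q ω‖ ≤ p + q := by
  rw [Real.norm_eq_abs, abs_le]
  exact ⟨by linarith [neg_le_minSlope hp hq ω], by linarith [minSlope_le hp hq ω]⟩

/-- Ties are assigned to the slope `p`, and the branch `ω p` stays active when `ω` decreases; hence
continuity from the left without any condition. -/
lemma continuousWithinAt_minSlope {p q : ℝ} (hp : 0 ≤ p) (hq : 0 ≤ q) (ω : ℝ) :
    ContinuousWithinAt (minSlope p q) (Iic ω) ω := by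
  by_cases h : ω * p ≤ (1 - ω) * q
  · refine (continuousWithinAt_const (b := p)).congr (fun x hx => ?_) (if_pos h)
    have hx : x ≤ ω := hx
    exact if_pos (by nlinarith)
  · have hev : ∀ᶠ x in 𝓝 ω, minSlope p q x = -q := by
      have hop : ∀ᶠ x in 𝓝 ω, (1 - x) * q < x * p :=
        ContinuousAt.eventually_lt (by fun_prop) (by fun_prop) (not_le.1 h)
      exact hop.mono fun x hx => if_neg (not_le.2 hx)
    exact (continuousAt_const.congr (EventuallyEq.symm hev)).continuousWithinAt

lemma continuousAt_minSlope {p q ω : ℝ} (h : ω * p ≠ (1 - ω) * q) :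
    ContinuousAt (minSlope p q) ω := by
  rcases lt_or_gt_of_ne h with h | h
  · have hop : ∀ᶠ x in 𝓝 ω, x * p < (1 - x) * q :=
      ContinuousAt.eventually_lt (by fun_prop) (by fun_prop) h
    exact (continuousAt_const (y := p)).congr (hop.mono fun x hx => (if_pos hx.le).symm)
  · have hop : ∀ᶠ x in 𝓝 ω, (1 - x) * q < x * p :=
      ContinuousAt.eventually_lt (by fun_prop) (by fun_prop) h
    exact (continuousAt_const (y := -q)).congr
      (hop.mono fun x hx => (if_neg (not_le.2 hx)).symm)

end PointwiseFormulas

/-! ### Supergradients and derivatives on the line. -/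

section Supergradient

/-- Subtracting the supporting line leaves a function with a local maximum at `x`. -/
lemma eq_of_hasDerivAt_of_eventually_le {f : ℝ → ℝ} {x c d : ℝ} (hf : HasDerivAt f d x)
    (h : ∀ᶠ y in 𝓝 x, f y ≤ f x + (y - x) * c) : c = d := by
  have hg : HasDerivAt (fun y => f y - (y - x) * c) (d - 1 * c) x :=
    hf.sub (((hasDerivAt_id x).sub_const x).mul_const c)
  have hmax : IsLocalMax (fun y => f y - (y - x) * c) x := by
    filter_upwards [h] with y hy
    simp only [sub_self, zero_mul, sub_zero]
    linarith
  linarith [hmax.hasDerivAt_eq_zero hg]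

/-- The supergradients at `x` and at `y` give `(y - x) g y ≤ f y - f x ≤ (y - x) g x`, so the
linearization error is at most `|(y - x) (g y - g x)|`. -/
lemma hasDerivAt_of_supergradient {f g : ℝ → ℝ} {x : ℝ}
    (h : ∀ y z, f z ≤ f y + (z - y) * g y) (hg : ContinuousAt g x) :
    HasDerivAt f (g x) x := by
  rw [hasDerivAt_iff_isLittleO]
  have hO : (fun y => f y - f x - (y - x) • g x) =O[𝓝 x] fun y => (y - x) * (g y - g x) := by
    refine Asymptotics.IsBigO.of_bound 1 (Eventually.of_forall fun y => ?_)
    have h1 := h x y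
    have h2 := h y x
    rw [one_mul, Real.norm_eq_abs, Real.norm_eq_abs, smul_eq_mul,
      abs_of_nonpos (by linarith : f y - f x - (y - x) * g x ≤ 0)]
    exact le_trans (by linarith) (neg_le_abs _)
  have ho : (fun y => g y - g x) =o[𝓝 x] fun _ => (1 : ℝ) := by
    rw [Asymptotics.isLittleO_one_iff]
    simpa using hg.tendsto.sub_const (g x)
  simpa using hO.trans_isLittleO ((Asymptotics.isBigO_refl (fun y => y - x) _).mul_isLittleO ho)

end Supergradient

/-! ### Densities with respect to `R`, and the spectrum as an integral. -/

section MidMeasure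

variable {A : Type*} [MeasurableSpace A]

instance (P Q : Measure A) [IsFiniteMeasure P] [IsFiniteMeasure Q] :
    IsFiniteMeasure (midMeasure P Q) := by
  unfold midMeasure
  exact (P + Q).smul_finite (by simp)

lemma absolutelyContinuous_midMeasure_left (P Q : Measure A) : P ≪ midMeasure P Q :=
  (Measure.AbsolutelyContinuous.rfl.add_right Q).smul_right (by simp)

lemma absolutelyContinuous_midMeasure_right (P Q : Measure A) : Q ≪ midMeasure P Q := by
  unfold midMeasure
  rw [add_comm]
  exact (Measure.AbsolutelyContinuous.rfl.add_right P).smul_right (by simp)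

/-- The real-valued density of `P` with respect to `midMeasure P Q`. -/
noncomputable def leftDensity (P Q : Measure A) (a : A) : ℝ :=
  (P.rnDeriv (midMeasure P Q) a).toReal

/-- The real-valued density of `Q` with respect to `midMeasure P Q`. -/
noncomputable def rightDensity (P Q : Measure A) (a : A) : ℝ :=
  (Q.rnDeriv (midMeasure P Q) a).toReal

lemma leftDensity_nonneg (P Q : Measure A) (a : A) : 0 ≤ leftDensity P Q a :=
  ENNReal.toReal_nonneg

lemma rightDensity_nonneg (P Q : Measure A) (a : A) : 0 ≤ rightDensity P Q a :=
  ENNReal.toReal_nonneg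

@[fun_prop]
lemma measurable_leftDensity (P Q : Measure A) : Measurable (leftDensity P Q) :=
  (Measure.measurable_rnDeriv _ _).ennreal_toReal

@[fun_prop]
lemma measurable_rightDensity (P Q : Measure A) : Measurable (rightDensity P Q) :=
  (Measure.measurable_rnDeriv _ _).ennreal_toReal

lemma integrable_leftDensity (P Q : Measure A) [IsFiniteMeasure P] :
    Integrable (leftDensity P Q) (midMeasure P Q) :=
  Measure.integrable_toReal_rnDeriv

lemma integrable_rightDensity (P Q : Measure A) [IsFiniteMeasure Q] :
    Integrable (rightDensity P Q) (midMeasure P Q) :=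
  Measure.integrable_toReal_rnDeriv

variable (P Q : Measure A) [IsProbabilityMeasure P] [IsProbabilityMeasure Q]

lemma integral_leftDensity : ∫ a, leftDensity P Q a ∂(midMeasure P Q) = 1 := by
  simpa [leftDensity] using
    Measure.integral_toReal_rnDeriv (absolutelyContinuous_midMeasure_left P Q)

lemma integral_rightDensity : ∫ a, rightDensity P Q a ∂(midMeasure P Q) = 1 := by
  simpa [rightDensity] using
    Measure.integral_toReal_rnDeriv (absolutelyContinuous_midMeasure_right P Q)

lemma ae_leftDensity_pos_or_rightDensity_pos :
    ∀ᵐ a ∂(midMeasure P Q), 0 < leftDensity P Q a ∨ 0 < rightDensity P Q a := by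
  have hP := absolutelyContinuous_midMeasure_left P Q
  have hQ := absolutelyContinuous_midMeasure_right P Q
  refine Measure.ae_smul_measure (ae_add_measure_iff.2 ⟨?_, ?_⟩) _
  · filter_upwards [Measure.rnDeriv_pos hP, hP.ae_le (P.rnDeriv_lt_top (midMeasure P Q))]
      with a h0 h1
    exact Or.inl (ENNReal.toReal_pos h0.ne' h1.ne)
  · filter_upwards [Measure.rnDeriv_pos hQ, hQ.ae_le (Q.rnDeriv_lt_top (midMeasure P Q))]
      with a h0 h1
    exact Or.inr (ENNReal.toReal_pos h0.ne' h1.ne)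

lemma relInfoSpectrum_log {ω : ℝ} (hω : ω ∈ Ioo (0 : ℝ) 1) :
    relInfoSpectrum P Q (Real.log ((1 - ω) / ω)) =
      ∫ a, (if ω * leftDensity P Q a ≤ (1 - ω) * rightDensity P Q a then leftDensity P Q a
        else 0) ∂(midMeasure P Q) := by
  have hP := absolutelyContinuous_midMeasure_left P Q
  have hS : MeasurableSet {a | ω * leftDensity P Q a ≤ (1 - ω) * rightDensity P Q a} :=
    measurableSet_le (by fun_prop) (by fun_prop)
  have hae : {a | relInfo P Q a ≤ (Real.log ((1 - ω) / ω) : EReal)} =ᵐ[P]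
      {a | ω * leftDensity P Q a ≤ (1 - ω) * rightDensity P Q a} := by
    filter_upwards [Measure.rnDeriv_pos hP, hP.ae_le (P.rnDeriv_lt_top (midMeasure P Q)),
      hP.ae_le (Q.rnDeriv_lt_top (midMeasure P Q))] with a h0 h1 h2
    exact propext (log_sub_log_le_iff h1.ne h2.ne h0.ne' hω)
  rw [relInfoSpectrum, measureReal_congr hae, ← Measure.setIntegral_toReal_rnDeriv hP,
    ← integral_indicator hS]
  rfl

lemma NoMasses.ae_ne {P Q : Measure A} [IsProbabilityMeasure P] [IsProbabilityMeasure Q]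
    (h : NoMasses P Q) {ω : ℝ} (hω : ω ∈ Ioo (0 : ℝ) 1) :
    ∀ᵐ a ∂(midMeasure P Q), ω * leftDensity P Q a ≠ (1 - ω) * rightDensity P Q a := by
  have hP := absolutelyContinuous_midMeasure_left P Q
  have h1 : ∀ᵐ a ∂((midMeasure P Q).withDensity (P.rnDeriv (midMeasure P Q))),
      relInfo P Q a ≠ (Real.log ((1 - ω) / ω) : EReal) := by
    rw [Measure.withDensity_rnDeriv_eq _ _ hP, ae_iff]
    simpa using h (Real.log ((1 - ω) / ω))
  -- A `P`-null set is `R`-null only within `p ≠ 0`. Where `p = 0`, a tie would force `q = 0` as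
  -- well, which happens only on an `R`-null set.
  rw [ae_withDensity_iff (Measure.measurable_rnDeriv _ _)] at h1
  filter_upwards [h1, P.rnDeriv_lt_top (midMeasure P Q), Q.rnDeriv_lt_top (midMeasure P Q),
    ae_leftDensity_pos_or_rightDensity_pos P Q] with a h1 h2 h3 h4 heq
  have hp0 : P.rnDeriv (midMeasure P Q) a ≠ 0 := by
    intro h0
    have hl : leftDensity P Q a = 0 := by simp [leftDensity, h0]
    rw [hl, mul_zero] at heq
    rcases h4 with h4 | h4
    · exact h4.ne' hl
    · exact (mul_pos (sub_pos.2 hω.2) h4).ne heq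
  exact h1 hp0 (log_sub_log_eq_of_mul_eq h2.ne h3.ne hp0 hω heq)

end MidMeasure

/-! ### The Bayes risk, its supergradient, and the derivative of the information. -/

section BayesRisk

variable {A : Type*} [MeasurableSpace A]

/-- The minimal error probability of the Bayesian test of `P`, with prior probability `ω`,
against `Q`. -/
noncomputable def bayesRisk (P Q : Measure A) (ω : ℝ) : ℝ :=
  ∫ a, min (ω * leftDensity P Q a) ((1 - ω) * rightDensity P Q a) ∂(midMeasure P Q)

/-- A supergradient of the concave function `bayesRisk P Q`. -/
noncomputable def bayesSlope (P Q : Measure A) (ω : ℝ) : ℝ :=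
  ∫ a, minSlope (leftDensity P Q a) (rightDensity P Q a) ω ∂(midMeasure P Q)

lemma aestronglyMeasurable_minSlope_density (P Q : Measure A) (ω : ℝ) : AEStronglyMeasurable
    (fun a => minSlope (leftDensity P Q a) (rightDensity P Q a) ω) (midMeasure P Q) := by
  unfold minSlope
  exact (Measurable.ite (measurableSet_le (by fun_prop) (by fun_prop)) (by fun_prop)
    (by fun_prop)).aestronglyMeasurable

lemma norm_minSlope_density_le (P Q : Measure A) (ω : ℝ) (a : A) :
    ‖minSlope (leftDensity P Q a) (rightDensity P Q a) ω‖ ≤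
      leftDensity P Q a + rightDensity P Q a :=
  norm_minSlope_le (leftDensity_nonneg P Q a) (rightDensity_nonneg P Q a) ω

variable (P Q : Measure A) [IsProbabilityMeasure P] [IsProbabilityMeasure Q]

lemma integrable_min_density (ω : ℝ) : Integrable
    (fun a => min (ω * leftDensity P Q a) ((1 - ω) * rightDensity P Q a)) (midMeasure P Q) :=
  ((integrable_leftDensity P Q).const_mul _).inf ((integrable_rightDensity P Q).const_mul _)

lemma integrable_minSlope_density (ω : ℝ) : Integrable
    (fun a => minSlope (leftDensity P Q a) (rightDensity P Q a) ω) (midMeasure P Q) :=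
  ((integrable_leftDensity P Q).add (integrable_rightDensity P Q)).mono'
    (aestronglyMeasurable_minSlope_density P Q ω)
    (Eventually.of_forall (norm_minSlope_density_le P Q ω))

lemma deGrootInfo_eq {ω : ℝ} (hω : ω ∈ Ioo (0 : ℝ) 1) :
    deGrootInfo P Q ω = min ω (1 - ω) - bayesRisk P Q ω := by
  have h : ∀ a, fIntegrand (deGrootFun ω) (P.rnDeriv (midMeasure P Q) a).toReal
      (Q.rnDeriv (midMeasure P Q) a).toReal = min ω (1 - ω) * rightDensity P Q a -
        min (ω * leftDensity P Q a) ((1 - ω) * rightDensity P Q a) := fun a =>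
    fIntegrand_deGrootFun hω (leftDensity_nonneg P Q a) (rightDensity_nonneg P Q a)
  rw [deGrootInfo, fDivergence, integral_congr_ae (Eventually.of_forall h),
    integral_sub ((integrable_rightDensity P Q).const_mul _) (integrable_min_density P Q ω),
    integral_const_mul, integral_rightDensity, mul_one, bayesRisk]

lemma bayesRisk_le_add_bayesSlope (ω ω' : ℝ) :
    bayesRisk P Q ω' ≤ bayesRisk P Q ω + (ω' - ω) * bayesSlope P Q ω := by
  unfold bayesRisk bayesSlope
  rw [← integral_const_mul, ← integral_add (integrable_min_density P Q ω)
    ((integrable_minSlope_density P Q ω).const_mul _)]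
  exact integral_mono (integrable_min_density P Q ω') ((integrable_min_density P Q ω).add
    ((integrable_minSlope_density P Q ω).const_mul _)) fun a => min_le_min_add_minSlope _ _ _ _

lemma bayesRisk_add_mul_bayesSlope {ω : ℝ} (hω : ω ∈ Ioo (0 : ℝ) 1) :
    bayesRisk P Q ω + (1 - ω) * bayesSlope P Q ω =
      relInfoSpectrum P Q (Real.log ((1 - ω) / ω)) := by
  rw [relInfoSpectrum_log P Q hω, bayesRisk, bayesSlope, ← integral_const_mul,
    ← integral_add (integrable_min_density P Q ω)
      ((integrable_minSlope_density P Q ω).const_mul _)]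
  exact integral_congr_ae (Eventually.of_forall fun a => min_add_mul_minSlope _ _ _)

lemma bayesSlope_le_one (ω : ℝ) : bayesSlope P Q ω ≤ 1 := by
  rw [← integral_leftDensity P Q]
  exact integral_mono (integrable_minSlope_density P Q ω) (integrable_leftDensity P Q)
    fun a => minSlope_le (leftDensity_nonneg P Q a) (rightDensity_nonneg P Q a) ω

lemma neg_one_le_bayesSlope (ω : ℝ) : -1 ≤ bayesSlope P Q ω := by
  rw [← integral_rightDensity P Q, ← integral_neg]
  exact integral_mono (integrable_rightDensity P Q).neg (integrable_minSlope_density P Q ω)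
    fun a => neg_le_minSlope (leftDensity_nonneg P Q a) (rightDensity_nonneg P Q a) ω

lemma continuousWithinAt_bayesSlope (ω : ℝ) :
    ContinuousWithinAt (bayesSlope P Q) (Iic ω) ω :=
  continuousWithinAt_of_dominated
    (Eventually.of_forall fun x => aestronglyMeasurable_minSlope_density P Q x)
    (Eventually.of_forall fun x => Eventually.of_forall (norm_minSlope_density_le P Q x))
    ((integrable_leftDensity P Q).add (integrable_rightDensity P Q))
    (Eventually.of_forall fun a => continuousWithinAt_minSlope (leftDensity_nonneg P Q a)
      (rightDensity_nonneg P Q a) ω)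

variable {P Q}

lemma NoMasses.continuousAt_bayesSlope (h : NoMasses P Q) {ω : ℝ} (hω : ω ∈ Ioo (0 : ℝ) 1) :
    ContinuousAt (bayesSlope P Q) ω :=
  continuousAt_of_dominated
    (Eventually.of_forall fun x => aestronglyMeasurable_minSlope_density P Q x)
    (Eventually.of_forall fun x => Eventually.of_forall (norm_minSlope_density_le P Q x))
    ((integrable_leftDensity P Q).add (integrable_rightDensity P Q))
    ((h.ae_ne hω).mono fun _ => continuousAt_minSlope)

lemma NoMasses.hasDerivAt_bayesRisk (h : NoMasses P Q) {ω : ℝ} (hω : ω ∈ Ioo (0 : ℝ) 1) :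
    HasDerivAt (bayesRisk P Q) (bayesSlope P Q ω) ω :=
  hasDerivAt_of_supergradient (bayesRisk_le_add_bayesSlope P Q) (h.continuousAt_bayesSlope hω)

lemma NoMasses.hasDerivAt_deGrootInfo_of_lt_half (h : NoMasses P Q) {ω : ℝ}
    (hω : ω ∈ Ioo (0 : ℝ) (1 / 2)) :
    HasDerivAt (deGrootInfo P Q) (1 - bayesSlope P Q ω) ω := by
  have hω' : ω ∈ Ioo (0 : ℝ) 1 := ⟨hω.1, by linarith [hω.2]⟩
  refine ((hasDerivAt_id ω).sub (h.hasDerivAt_bayesRisk hω')).congr_of_eventuallyEq ?_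
  filter_upwards [Ioo_mem_nhds hω.1 hω.2] with x hx
  rw [deGrootInfo_eq P Q ⟨hx.1, by linarith [hx.2]⟩, min_eq_left (by linarith [hx.2])]
  rfl

lemma NoMasses.hasDerivAt_deGrootInfo_of_half_lt (h : NoMasses P Q) {ω : ℝ}
    (hω : ω ∈ Ioo (1 / 2 : ℝ) 1) :
    HasDerivAt (deGrootInfo P Q) (-1 - bayesSlope P Q ω) ω := by
  have hω' : ω ∈ Ioo (0 : ℝ) 1 := ⟨by linarith [hω.1], hω.2⟩
  refine (((hasDerivAt_id ω).const_sub 1).sub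
    (h.hasDerivAt_bayesRisk hω')).congr_of_eventuallyEq ?_
  filter_upwards [Ioo_mem_nhds hω.1 hω.2] with x hx
  rw [deGrootInfo_eq P Q ⟨by linarith [hx.1], hx.2⟩, min_eq_right (by linarith [hx.1])]
  rfl

lemma NoMasses.tendsto_deriv_deGrootInfo_left (h : NoMasses P Q) :
    Tendsto (deriv (deGrootInfo P Q)) (𝓝[<] (1 / 2)) (𝓝 (1 - bayesSlope P Q (1 / 2))) := by
  have hc := (h.continuousAt_bayesSlope (ω := 1 / 2) ⟨by norm_num, by norm_num⟩).tendsto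
  refine ((hc.mono_left nhdsWithin_le_nhds).const_sub 1).congr' ?_
  filter_upwards [Ioo_mem_nhdsLT (show (0 : ℝ) < 1 / 2 by norm_num)] with x hx
  exact (h.hasDerivAt_deGrootInfo_of_lt_half hx).deriv.symm

lemma NoMasses.tendsto_deriv_deGrootInfo_right (h : NoMasses P Q) :
    Tendsto (deriv (deGrootInfo P Q)) (𝓝[>] (1 / 2)) (𝓝 (-1 - bayesSlope P Q (1 / 2))) := by
  have hc := (h.continuousAt_bayesSlope (ω := 1 / 2) ⟨by norm_num, by norm_num⟩).tendsto
  refine ((hc.mono_left nhdsWithin_le_nhds).const_sub (-1)).congr' ?_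
  filter_upwards [Ioo_mem_nhdsGT (show (1 / 2 : ℝ) < 1 by norm_num)] with x hx
  exact (h.hasDerivAt_deGrootInfo_of_half_lt hx).deriv.symm

lemma NoMasses.contDiffOn_deGrootInfo (h : NoMasses P Q) :
    ContDiffOn ℝ 1 (deGrootInfo P Q) (Ioo 0 (1 / 2) ∪ Ioo (1 / 2) 1) := by
  have hopen : IsOpen (Ioo (0 : ℝ) (1 / 2) ∪ Ioo (1 / 2) 1) := isOpen_Ioo.union isOpen_Ioo
  rw [show (1 : WithTop ℕ∞) = 0 + 1 from (zero_add 1).symm,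
    contDiffOn_succ_iff_deriv_of_isOpen hopen]
  refine ⟨?_, by simp, contDiffOn_zero.2 ?_⟩
  · rintro ω (hω | hω)
    · exact (h.hasDerivAt_deGrootInfo_of_lt_half hω).differentiableAt.differentiableWithinAt
    · exact (h.hasDerivAt_deGrootInfo_of_half_lt hω).differentiableAt.differentiableWithinAt
  · rintro ω (hω | hω)
    · have hc := h.continuousAt_bayesSlope (ω := ω) ⟨hω.1, by linarith [hω.2]⟩
      refine ((continuousAt_const (y := (1 : ℝ))).sub hc |>.congr ?_).continuousWithinAt
      filter_upwards [Ioo_mem_nhds hω.1 hω.2] with x hx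
      exact (h.hasDerivAt_deGrootInfo_of_lt_half hx).deriv.symm
    · have hc := h.continuousAt_bayesSlope (ω := ω) ⟨by linarith [hω.1], hω.2⟩
      refine ((continuousAt_const (y := (-1 : ℝ))).sub hc |>.congr ?_).continuousWithinAt
      filter_upwards [Ioo_mem_nhds hω.1 hω.2] with x hx
      exact (h.hasDerivAt_deGrootInfo_of_half_lt hx).deriv.symm

lemma NoMasses.monotoneOn_deGrootInfo (h : NoMasses P Q) :
    MonotoneOn (deGrootInfo P Q) (Ioo 0 (1 / 2)) := by
  refine monotoneOn_of_deriv_nonneg (convex_Ioo _ _) (fun ω hω =>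
    (h.hasDerivAt_deGrootInfo_of_lt_half hω).continuousAt.continuousWithinAt) ?_ ?_ <;>
    rw [interior_Ioo]
  · exact fun ω hω =>
      (h.hasDerivAt_deGrootInfo_of_lt_half hω).differentiableAt.differentiableWithinAt
  · intro ω hω
    rw [(h.hasDerivAt_deGrootInfo_of_lt_half hω).deriv]
    linarith [bayesSlope_le_one P Q ω]

lemma NoMasses.antitoneOn_deGrootInfo (h : NoMasses P Q) :
    AntitoneOn (deGrootInfo P Q) (Ioo (1 / 2) 1) := by
  refine antitoneOn_of_deriv_nonpos (convex_Ioo _ _) (fun ω hω =>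
    (h.hasDerivAt_deGrootInfo_of_half_lt hω).continuousAt.continuousWithinAt) ?_ ?_ <;>
    rw [interior_Ioo]
  · exact fun ω hω =>
      (h.hasDerivAt_deGrootInfo_of_half_lt hω).differentiableAt.differentiableWithinAt
  · intro ω hω
    rw [(h.hasDerivAt_deGrootInfo_of_half_lt hω).deriv]
    linarith [neg_one_le_bayesSlope P Q ω]

end BayesRisk

/-! ### Recovering the spectrum from the information. -/

section Determination

variable {A A' : Type*} [MeasurableSpace A] [MeasurableSpace A']
  {P Q : Measure A} [IsProbabilityMeasure P] [IsProbabilityMeasure Q]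
  {P' Q' : Measure A'} [IsProbabilityMeasure P'] [IsProbabilityMeasure Q']

lemma bayesRisk_eq_of_deGrootInfo_eq {ω : ℝ} (hω : ω ∈ Ioo (0 : ℝ) 1)
    (h : deGrootInfo P' Q' ω = deGrootInfo P Q ω) : bayesRisk P' Q' ω = bayesRisk P Q ω := by
  rw [deGrootInfo_eq P' Q' hω, deGrootInfo_eq P Q hω] at h
  linarith

lemma NoMasses.bayesSlope_eq (hPQ : NoMasses P Q) {ω : ℝ} (hω : ω ∈ Ioo (0 : ℝ) 1)
    (h : bayesRisk P' Q' =ᶠ[𝓝 ω] bayesRisk P Q) : bayesSlope P' Q' ω = bayesSlope P Q ω :=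
  eq_of_hasDerivAt_of_eventually_le ((hPQ.hasDerivAt_bayesRisk hω).congr_of_eventuallyEq h)
    (Eventually.of_forall (bayesRisk_le_add_bayesSlope P' Q' ω))

/-- Both slopes are left continuous even with masses; this reaches the endpoint `ω = 1/2`, that is
`x = 0`. -/
lemma bayesSlope_eq_of_eqOn_Ioo {l ω : ℝ} (hl : l < ω)
    (h : EqOn (bayesSlope P' Q') (bayesSlope P Q) (Ioo l ω)) :
    bayesSlope P' Q' ω = bayesSlope P Q ω := by
  have h1 := (continuousWithinAt_bayesSlope P' Q' ω).mono Iio_subset_Iic_self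
  have h2 := (continuousWithinAt_bayesSlope P Q ω).mono Iio_subset_Iic_self
  refine tendsto_nhds_unique (h1.tendsto.congr' ?_) h2.tendsto
  filter_upwards [Ioo_mem_nhdsLT hl] with x hx using h hx

lemma exists_log_odds_eq (x : ℝ) :
    ∃ ω ∈ Ioo (0 : ℝ) 1, Real.log ((1 - ω) / ω) = x ∧ (0 ≤ x → ω ≤ 1 / 2) ∧
      (x < 0 → 1 / 2 < ω) := by
  have he := Real.exp_pos x
  have h1 : (1 + Real.exp x) * (1 + Real.exp x)⁻¹ = 1 := mul_inv_cancel₀ (by positivity)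
  -- This solves `(1 - ω) / ω = exp x`.
  refine ⟨(1 + Real.exp x)⁻¹, ⟨by positivity, inv_lt_one_of_one_lt₀ (by linarith)⟩, ?_, ?_, ?_⟩
  · have : (1 - (1 + Real.exp x)⁻¹) / (1 + Real.exp x)⁻¹ = Real.exp x := by
      field_simp
      ring
    rw [this, Real.log_exp]
  · intro hx
    rw [one_div]
    exact inv_anti₀ (by norm_num) (by linarith [Real.one_le_exp hx])
  · intro hx
    rw [one_div]
    exact inv_strictAnti₀ (by positivity) (by linarith [Real.exp_zero, Real.exp_lt_exp.2 hx])

lemma NoMasses.relInfoSpectrum_eq_of_nonneg (hPQ : NoMasses P Q)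
    (h : ∀ ω ∈ Ioc (0 : ℝ) (1 / 2), deGrootInfo P' Q' ω = deGrootInfo P Q ω) {x : ℝ}
    (hx : 0 ≤ x) : relInfoSpectrum P' Q' x = relInfoSpectrum P Q x := by
  obtain ⟨ω, hω, rfl, hle, -⟩ := exists_log_odds_eq x
  have hB : ∀ y ∈ Ioc (0 : ℝ) (1 / 2), bayesRisk P' Q' y = bayesRisk P Q y := fun y hy =>
    bayesRisk_eq_of_deGrootInfo_eq ⟨hy.1, by linarith [hy.2]⟩ (h y hy)
  have hD : ∀ y ∈ Ioo (0 : ℝ) (1 / 2), bayesSlope P' Q' y = bayesSlope P Q y := fun y hy =>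
    hPQ.bayesSlope_eq ⟨hy.1, by linarith [hy.2]⟩
      (by filter_upwards [Ioo_mem_nhds hy.1 hy.2] with z hz using hB z ⟨hz.1, hz.2.le⟩)
  rw [← bayesRisk_add_mul_bayesSlope P' Q' hω, ← bayesRisk_add_mul_bayesSlope P Q hω,
    hB ω ⟨hω.1, hle hx⟩,
    bayesSlope_eq_of_eqOn_Ioo hω.1 fun y hy => hD y ⟨hy.1, hy.2.trans_le (hle hx)⟩]

lemma NoMasses.relInfoSpectrum_eq_of_neg (hPQ : NoMasses P Q)
    (h : ∀ ω ∈ Ioo (1 / 2 : ℝ) 1, deGrootInfo P' Q' ω = deGrootInfo P Q ω) {x : ℝ}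
    (hx : x < 0) : relInfoSpectrum P' Q' x = relInfoSpectrum P Q x := by
  obtain ⟨ω, hω, rfl, -, hlt⟩ := exists_log_odds_eq x
  have hB : ∀ y ∈ Ioo (1 / 2 : ℝ) 1, bayesRisk P' Q' y = bayesRisk P Q y := fun y hy =>
    bayesRisk_eq_of_deGrootInfo_eq ⟨by linarith [hy.1], hy.2⟩ (h y hy)
  rw [← bayesRisk_add_mul_bayesSlope P' Q' hω, ← bayesRisk_add_mul_bayesSlope P Q hω,
    hB ω ⟨hlt hx, hω.2⟩, hPQ.bayesSlope_eq hω
      (by filter_upwards [Ioo_mem_nhds (hlt hx) hω.2] with z hz using hB z hz)]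

end Determination

theorem theorem4 {A : Type*} [MeasurableSpace A] (P Q : Measure A)
    [IsProbabilityMeasure P] [IsProbabilityMeasure Q] (hPQ : NoMasses P Q) :
    -- (a) regularity, jump of the derivative at `1/2`, and monotonicity
    (ContDiffOn ℝ 1 (deGrootInfo P Q) (Ioo 0 (1 / 2) ∪ Ioo (1 / 2) 1) ∧
      (∃ l r : ℝ, Tendsto (deriv (deGrootInfo P Q)) (𝓝[<] (1 / 2)) (𝓝 l) ∧
        Tendsto (deriv (deGrootInfo P Q)) (𝓝[>] (1 / 2)) (𝓝 r) ∧ l - r = 2) ∧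
      (∀ ω ∈ Ioo (0 : ℝ) (1 / 2), 0 ≤ deriv (deGrootInfo P Q) ω) ∧
      (∀ ω ∈ Ioo (1 / 2 : ℝ) 1, deriv (deGrootInfo P Q) ω ≤ 0) ∧
      MonotoneOn (deGrootInfo P Q) (Ioo 0 (1 / 2)) ∧
      AntitoneOn (deGrootInfo P Q) (Ioo (1 / 2) 1)) ∧
    -- (b) the values on `(0, 1/2]` and on `(1/2, 1)` determine the spectrum on
    -- `[0, ∞)` and on `(-∞, 0)`, respectively
    (∀ (A' : Type*) [MeasurableSpace A'] (P' Q' : Measure A')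
      [IsProbabilityMeasure P'] [IsProbabilityMeasure Q'],
      ((∀ ω ∈ Ioc (0 : ℝ) (1 / 2), deGrootInfo P' Q' ω = deGrootInfo P Q ω) →
        ∀ x : ℝ, 0 ≤ x → relInfoSpectrum P' Q' x = relInfoSpectrum P Q x) ∧
      ((∀ ω ∈ Ioo (1 / 2 : ℝ) 1, deGrootInfo P' Q' ω = deGrootInfo P Q ω) →
        ∀ x : ℝ, x < 0 → relInfoSpectrum P' Q' x = relInfoSpectrum P Q x)) ∧
    -- (c) explicit formulas
    ((∀ ω ∈ Ioo (0 : ℝ) (1 / 2),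
        relInfoSpectrum P Q (Real.log ((1 - ω) / ω)) =
          1 - deGrootInfo P Q ω - (1 - ω) * deriv (deGrootInfo P Q) ω) ∧
      (∀ ω ∈ Ioo (1 / 2 : ℝ) 1,
        relInfoSpectrum P Q (Real.log ((1 - ω) / ω)) =
          - deGrootInfo P Q ω - (1 - ω) * deriv (deGrootInfo P Q) ω) ∧
      (∃ r : ℝ, Tendsto (deriv (deGrootInfo P Q)) (𝓝[>] (1 / 2)) (𝓝 r) ∧
        relInfoSpectrum P Q 0 = - deGrootInfo P Q (1 / 2) - 1 / 2 * r)) := by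
  refine ⟨⟨hPQ.contDiffOn_deGrootInfo, ⟨_, _, hPQ.tendsto_deriv_deGrootInfo_left,
    hPQ.tendsto_deriv_deGrootInfo_right, by ring⟩, fun ω hω => ?_, fun ω hω => ?_,
    hPQ.monotoneOn_deGrootInfo, hPQ.antitoneOn_deGrootInfo⟩, ?_, fun ω hω => ?_, fun ω hω => ?_,
    _, hPQ.tendsto_deriv_deGrootInfo_right, ?_⟩
  · rw [(hPQ.hasDerivAt_deGrootInfo_of_lt_half hω).deriv]
    linarith [bayesSlope_le_one P Q ω]
  · rw [(hPQ.hasDerivAt_deGrootInfo_of_half_lt hω).deriv]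
    linarith [neg_one_le_bayesSlope P Q ω]
  · intro A' _ P' Q' _ _
    exact ⟨fun h x hx => hPQ.relInfoSpectrum_eq_of_nonneg h hx,
      fun h x hx => hPQ.relInfoSpectrum_eq_of_neg h hx⟩
  · have hω' : ω ∈ Ioo (0 : ℝ) 1 := ⟨hω.1, by linarith [hω.2]⟩
    rw [(hPQ.hasDerivAt_deGrootInfo_of_lt_half hω).deriv, deGrootInfo_eq P Q hω',
      ← bayesRisk_add_mul_bayesSlope P Q hω', min_eq_left (by linarith [hω.2])]
    ring
  · have hω' : ω ∈ Ioo (0 : ℝ) 1 := ⟨by linarith [hω.1], hω.2⟩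
    rw [(hPQ.hasDerivAt_deGrootInfo_of_half_lt hω).deriv, deGrootInfo_eq P Q hω',
      ← bayesRisk_add_mul_bayesSlope P Q hω', min_eq_right (by linarith [hω.1])]
    ring
  · have hω : (1 / 2 : ℝ) ∈ Ioo (0 : ℝ) 1 := ⟨by norm_num, by norm_num⟩
    have h0 : Real.log ((1 - 1 / 2) / (1 / 2)) = 0 := by norm_num
    rw [← h0, ← bayesRisk_add_mul_bayesSlope P Q hω, deGrootInfo_eq P Q hω,
      min_eq_left (by norm_num)]
    ring
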